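/- Let $\mathbb F$ be a field and $\mathbf{As}$ the category of unital associative $\mathbb F$-algebras, with coproduct $\amalg$ (the free product) and initial object $\mathbb F$. A loop is a set with a multiplication, a two-sided unit, a right division $/$ and a left division $\backslash$ such that $(a/b)\cdot b=a$, $(a\cdot b)/b=a$, $a\cdot(a\backslash b)=b$, $a\backslash(a\cdot b)=b$; homomorphisms of loops are the maps preserving the multiplication. For a unital associative algebra $A$, let $\mathrm{Diff}(A)$ be the loop of formal series $a=\sum_{n\ge 0}a_n\lambda^{n+1}$ with $a_n\in A$, $a_0=1$, with unit $e=\lambda$ and multiplication the composition $$(a\circ b)_n=\sum_{m=0}^n\ \sum_{k_0+\cdots+k_m=n-m,\ k_i\ge 0} a_m\,b_{k_0}\cdots b_{k_m};$$ algebra homomorphisms act on $\mathrm{Diff}$ coefficientwise. Notation. $\mathcal C_n^{\ell}$ is the set of sequences $(n_1,\dots,n_\ell)$ of positive integers with sum $n$. $\mathcal M_\ell$ is the set of sequences $(m_1,\dots,m_\ell)$ of non-negative integers with $m_1+\cdots+m_\ell=\ell$ and $m_1+\cdots+m_j\ge j$ for $1\le j\le \ell$. $\mathcal E_\ell=\{1,2\}^\ell$,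 and for $\mathbf e\in\mathcal E_\ell$ let $\mathcal M_\ell^{\mathbf e}$ be the set of $\mathbf m\in\mathcal M_\ell$ with $m_i=0$ whenever $e_i=2$ ($1\le i\le\ell$), and $(-1)^{\mathbf e}=(-1)^{e_1+\cdots+e_\ell-\ell}$. The Lagrange coefficients and labeled Lagrange coefficients are $$d_\ell(n_1,\dots,n_\ell)=\sum_{\mathbf m\in\mathcal M_\ell}\prod_{i=1}^\ell\binom{n_i+1}{m_i},\qquad d^{\mathbf e}_\ell(n_1,\dots,n_\ell)=\sum_{\mathbf m\in\mathcal M^{\mathbf e}_\ell}\prod_{i=1}^\ell\binom{n_i+1}{m_i},\qquad d_0=d_0^{\mathbf e}=1.$$ Let $H=\mathbb F\langle x_n,\ n\ge1\rangle$ be the free unital associative algebra, $x_0=1$, and write $x_n=x_n^{(1)}$, $y_n=x_n^{(2)}$ for the generators in the first and second copy of $H$ in $H\amalg H$. Let $\Delta,\delta_r,\delta_l:H\to H\amalg H$ and $\varepsilon:H\to\mathbb F$ be the algebra homomorphisms given for $n\ge1$ by $\varepsilon(x_n)=0$ and $$\Delta(x_n)=x_n+y_n+\sum_{\ell=1}^{n-1}\sum_{\mathbf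 n\in\mathcal C_n^{\ell+1}}\binom{n_1+1}{\ell}x_{n_1}y_{n_2}\cdots y_{n_{\ell+1}},$$ $$\delta_r(x_n)=\sum_{\ell=0}^{n-1}(-1)^\ell\sum_{\mathbf n\in\mathcal C_n^{\ell+1}}d_\ell(n_1,\dots,n_\ell)\,(x_{n_1}-y_{n_1})\,y_{n_2}\cdots y_{n_{\ell+1}},$$ $$\delta_l(x_n)=\sum_{\ell=0}^{n-1}(-1)^\ell\sum_{\mathbf n\in\mathcal C_n^{\ell+1}}\sum_{\mathbf e\in\mathcal E_\ell}(-1)^{\mathbf e}d^{\mathbf e}_\ell(n_1,\dots,n_\ell)\,x^{(e_1)}_{n_1}\cdots x^{(e_\ell)}_{n_\ell}\,(y_{n_{\ell+1}}-x_{n_{\ell+1}}).$$ Theorem. $H$ with $\Delta,\varepsilon,\delta_r,\delta_l$ is a coloop in $\mathbf{As}$, that is, with $\mu:H\amalg H\to H$ the folding map and $i_1,i_2$ the canonical maps, $$(\varepsilon\amalg\mathrm{id})\Delta=i_2,\qquad(\mathrm{id}\amalg\varepsilon)\Delta=i_1,$$ $$(\mathrm{id}\amalg\mu)(\delta_r\amalg\mathrm{id})\Delta=i_1=(\mathrm{id}\amalg\mu)(\Delta\amalg\mathrm{id})\delta_r,\qquad(\mu\amalg\mathrm{id})(\mathrm{id}\amalg\delta_l)\Delta=i_2=(\mu\amalg\mathrm{id})(\mathrm{id}\amalg\Delta)\delta_l,$$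 and it represents $\mathrm{Diff}:\mathbf{As}\to\mathbf{Loop}$: the maps sending an algebra homomorphism $\alpha:H\to A$ to the series $\sum_{n\ge0}\alpha(x_n)\lambda^{n+1}$ form an isomorphism of functors in loops from $A\mapsto\mathrm{Hom}_{\mathbf{As}}(H,A)$, with the loop operations $\mu_A(\alpha\amalg\beta)\Delta$, $\mu_A(\alpha\amalg\beta)\delta_r$ (right division), $\mu_A(\alpha\amalg\beta)\delta_l$ (left division), to $\mathrm{Diff}$. Moreover, for every unital associative algebra $A$ and all $a,b\in\mathrm{Diff}(A)$, regarded also as algebra homomorphisms $H\to A$ with $a(x_n)=a_n$, $b(x_n)=b_n$, one has for all $n\ge1$ $$(a/b)_n=\mu_A(a\amalg b)\delta_r(x_n)=a_n-b_n+\sum_{\ell=1}^{n-1}(-1)^\ell\sum_{\mathbf n\in\mathcal C_n^{\ell+1}}d_\ell(n_1,\dots,n_\ell)\,(a_{n_1}-b_{n_1})\,b_{n_2}\cdots b_{n_{\ell+1}},$$ $$(a\backslash b)_n=\mu_A(a\amalg b)\delta_l(x_n)=b_n-a_n+\sum_{\ell=1}^{n-1}(-1)^\ell\sum_{\mathbf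 n\in\mathcal C_n^{\ell+1}}\sum_{\mathbf e\in\mathcal E_\ell}(-1)^{\mathbf e}d^{\mathbf e}_\ell(n_1,\dots,n_\ell)\,c^{(e_1)}_{n_1}\cdots c^{(e_\ell)}_{n_\ell}\,(b_{n_{\ell+1}}-a_{n_{\ell+1}}),$$ where $c^{(1)}_k=a_k$ and $c^{(2)}_k=b_k$. -/

import Mathlib

open CategoryTheory CategoryTheory.Limits

universe v u

namespace FdB

/-! ### Loops -/

/-- A loop: a set with a multiplication, a two-sided unit, a right division `rdiv a b = a / b` and
a left division `ldiv a b = a \ b` satisfying the cancellation properties. -/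
class Loop (Q : Type u) extends Mul Q, One Q where
  rdiv : Q → Q → Q
  ldiv : Q → Q → Q
  one_mul' : ∀ a : Q, 1 * a = a
  mul_one' : ∀ a : Q, a * 1 = a
  mul_ldiv : ∀ a b : Q, a * ldiv a b = b
  ldiv_mul : ∀ a b : Q, ldiv a (a * b) = b
  rdiv_mul : ∀ a b : Q, rdiv a b * b = a
  mul_rdiv : ∀ a b : Q, rdiv (a * b) b = a

/-- Bundled loops. -/
structure LoopCat where
  carrier : Type u
  [str : Loop carrier]

attribute [instance] LoopCat.str

/-- A homomorphism of loops is a map which preserves the multiplication (it then automatically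
preserves the unit and the divisions). -/
@[ext]
structure LoopCat.Hom (P Q : LoopCat.{u}) where
  toFun : P.carrier → Q.carrier
  map_mul : ∀ a b, toFun (a * b) = toFun a * toFun b

/-- The category of loops. -/
instance : Category LoopCat.{u} where
  Hom P Q := LoopCat.Hom P Q
  id P := ⟨fun a => a, fun _ _ => rfl⟩
  comp f g := ⟨fun a => g.toFun (f.toFun a), fun a b => by rw [f.map_mul, g.map_mul]⟩

/-! ### Coloops in a category with binary coproducts and an initial object -/

section Coloop

variable {C : Type u} [Category.{v} C] [HasBinaryCoproducts C]

/-- Convolution of two maps `α, β : H ⟶ A` along a co-operation `δ : H ⟶ H ⨿ H`, that is,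
`μ_A (α ⨿ β) δ`. -/
noncomputable def conv {H A : C} (δ : H ⟶ H ⨿ H) (α β : H ⟶ A) : H ⟶ A :=
  δ ≫ coprod.map α β ≫ codiag A

theorem conv_eq_desc {H A : C} (δ : H ⟶ H ⨿ H) (α β : H ⟶ A) :
    conv δ α β = δ ≫ coprod.desc α β := by
  simp [conv]

theorem conv_right {H A : C} (γ δ : H ⟶ H ⨿ H)
    (h : γ ≫ coprod.map δ (𝟙 H) ≫ (coprod.associator H H H).hom ≫
      coprod.map (𝟙 H) (codiag H) = coprod.inl) (α β : H ⟶ A) :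
    conv γ (conv δ α β) β = α := by
  have h2 := congrArg (· ≫ coprod.desc α β) h
  simp only [coprod.inl_desc] at h2
  refine Eq.trans ?_ h2
  rw [conv_eq_desc, conv_eq_desc]
  simp only [Category.assoc]
  congr 1
  ext <;> simp [coprod.inl_desc, coprod.inr_desc]

theorem conv_left {H A : C} (γ δ : H ⟶ H ⨿ H)
    (h : γ ≫ coprod.map (𝟙 H) δ ≫ (coprod.associator H H H).inv ≫
      coprod.map (codiag H) (𝟙 H) = coprod.inr) (α β : H ⟶ A) :
    conv γ α (conv δ α β) = β := by
  have h2 := congrArg (· ≫ coprod.desc α β) h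
  simp only [coprod.inr_desc] at h2
  refine Eq.trans ?_ h2
  rw [conv_eq_desc, conv_eq_desc]
  simp only [Category.assoc]
  congr 1
  ext <;> simp [coprod.inl_desc, coprod.inr_desc]

variable [HasInitial C]

/-- The structure of a coloop on an object `H` of `C`: comultiplication, counit, right and left
codivision, with the counitary and the cocancellation properties. -/
structure Coloop (H : C) where
  comul : H ⟶ H ⨿ H
  counit : H ⟶ ⊥_ C
  rcodiv : H ⟶ H ⨿ H
  lcodiv : H ⟶ H ⨿ H
  counit_left : comul ≫ coprod.map counit (𝟙 H) = coprod.inr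
  counit_right : comul ≫ coprod.map (𝟙 H) counit = coprod.inl
  rcodiv_comul : comul ≫ coprod.map rcodiv (𝟙 H) ≫ (coprod.associator H H H).hom ≫
    coprod.map (𝟙 H) (codiag H) = coprod.inl
  comul_rcodiv : rcodiv ≫ coprod.map comul (𝟙 H) ≫ (coprod.associator H H H).hom ≫
    coprod.map (𝟙 H) (codiag H) = coprod.inl
  lcodiv_comul : comul ≫ coprod.map (𝟙 H) lcodiv ≫ (coprod.associator H H H).inv ≫
    coprod.map (codiag H) (𝟙 H) = coprod.inr
  comul_lcodiv : lcodiv ≫ coprod.map (𝟙 H) comul ≫ (coprod.associator H H H).inv ≫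
    coprod.map (codiag H) (𝟙 H) = coprod.inr

/-- The convolution loop `Hom(H, A)` of a coloop `H`, with the unit `u_A ε`. -/
@[reducible]
noncomputable def Coloop.homLoop {H : C} (S : Coloop H) (A : C) : Loop (H ⟶ A) where
  mul α β := conv S.comul α β
  one := S.counit ≫ initial.to A
  rdiv α β := conv S.rcodiv α β
  ldiv α β := conv S.lcodiv α β
  one_mul' α := by
    change conv S.comul (S.counit ≫ initial.to A) α = α
    have h2 := congrArg (· ≫ coprod.desc (initial.to A) α) S.counit_left
    simpa [conv_eq_desc, coprod.inl_desc, coprod.inr_desc] using h2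
  mul_one' α := by
    change conv S.comul α (S.counit ≫ initial.to A) = α
    have h2 := congrArg (· ≫ coprod.desc α (initial.to A)) S.counit_right
    simpa [conv_eq_desc, coprod.inl_desc, coprod.inr_desc] using h2
  mul_ldiv α β := conv_left _ _ S.lcodiv_comul α β
  ldiv_mul α β := conv_left _ _ S.comul_lcodiv α β
  rdiv_mul α β := conv_right _ _ S.rcodiv_comul α β
  mul_rdiv α β := conv_right _ _ S.comul_rcodiv α β

/-- The representable functor in loops `A ↦ Hom(H, A)` associated to a coloop `H`. -/
noncomputable def Coloop.functor {H : C} (S : Coloop H) : C ⥤ LoopCat.{v} where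
  obj A := @LoopCat.mk (H ⟶ A) (S.homLoop A)
  map f := ⟨fun α => α ≫ f, fun α β => by
    change conv S.comul α β ≫ f = conv S.comul (α ≫ f) (β ≫ f)
    simp [conv_eq_desc]⟩
  map_id A := LoopCat.Hom.ext (funext fun α => Category.comp_id α)
  map_comp f g := LoopCat.Hom.ext (funext fun α => (Category.assoc α f g).symm)

end Coloop

/-! ### Coproducts and initial object in unital associative algebras -/

section AlgCat

variable (F : Type u) [Field F]

/-- The algebra `F` is initial in the category of unital associative `F`-algebras. -/
def baseIsInitial : IsInitial (AlgCat.of F F) :=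
  IsInitial.ofUniqueHom (fun A => AlgCat.ofHom (Algebra.ofId F A)) fun A f => by
    apply AlgCat.hom_ext
    exact Subsingleton.elim _ _

instance : HasInitial (AlgCat.{u} F) := (baseIsInitial F).hasInitial

variable {F} in
/-- The family of algebra maps underlying a cocone over a pair of algebras. -/
def coconeMaps {K : Discrete WalkingPair ⥤ AlgCat.{u} F} (c : Cocone K) (j : WalkingPair) :
    K.obj ⟨j⟩ →ₐ[F] c.pt :=
  (c.ι.app ⟨j⟩).hom

/-- The coproduct in unital associative algebras is the free product. -/
instance : HasBinaryCoproducts (AlgCat.{u} F) := by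
  classical
  refine ⟨fun K => ⟨⟨⟨⟨AlgCat.of F (LinearAlgebra.FreeProduct F fun j : WalkingPair => K.obj ⟨j⟩),
    Discrete.natTrans fun j =>
      AlgCat.ofHom (LinearAlgebra.FreeProduct.ι F (fun j : WalkingPair => K.obj ⟨j⟩) j.as)⟩,
    ⟨fun c => AlgCat.ofHom (LinearAlgebra.FreeProduct.lift F
      (fun j : WalkingPair => K.obj ⟨j⟩) fun {j} => coconeMaps c j), ?_, ?_⟩⟩⟩⟩⟩
  · rintro c ⟨j⟩
    apply AlgCat.hom_ext
    exact LinearAlgebra.FreeProduct.lift_comp_ι F (fun j : WalkingPair => K.obj ⟨j⟩)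
      (fun {j} => coconeMaps c j)
  · intro c m hm
    apply AlgCat.hom_ext
    refine LinearAlgebra.FreeProduct.lift_unique F (fun j : WalkingPair => K.obj ⟨j⟩)
      (fun {j} => coconeMaps c j) _ ?_
    intro j
    exact congrArg AlgCat.Hom.hom (hm ⟨j⟩)

end AlgCat

/-! ### The loop of formal diffeomorphisms -/

/-- The set `Diff(A)` of formal diffeomorphisms `∑_{n ≥ 0} a_n λ^(n+1)` with `a_0 = 1`, recorded
by their sequences of coefficients `a_n`. -/
@[ext]
structure Diff (A : Type u) [Ring A] where
  coeff : ℕ → A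
  coeff_zero : coeff 0 = 1

section Diff

variable {A : Type u} [Ring A]

/-- `∑_{t_1 + ⋯ + t_k = s, t_i ≥ 0} b_{t_1} ⋯ b_{t_k}`, the product being taken in this order. -/
def powCoeff (b : ℕ → A) (k s : ℕ) : A :=
  ∑ t ∈ Finset.Nat.antidiagonalTuple k s, (List.ofFn fun i => b (t i)).prod

/-- The coefficients of the composition `a ∘ b`:
`(a ∘ b)_n = ∑_{m=0}^n ∑_{k_0 + ⋯ + k_m = n - m} a_m b_{k_0} ⋯ b_{k_m}`. -/
def compCoeff (a b : ℕ → A) (n : ℕ) : A :=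
  ∑ m ∈ Finset.range (n + 1), a m * powCoeff b (m + 1) (n - m)

theorem powCoeff_congr {x y : ℕ → A} {N : ℕ} (h : ∀ s ≤ N, x s = y s) (k : ℕ) :
    powCoeff x k N = powCoeff y k N := by
  unfold powCoeff
  refine Finset.sum_congr rfl fun t ht => ?_
  rw [Finset.Nat.mem_antidiagonalTuple] at ht
  congr 2
  funext i
  exact h _ (ht ▸ Finset.single_le_sum (fun _ _ => Nat.zero_le _) (Finset.mem_univ i))

theorem powCoeff_one (b : ℕ → A) (s : ℕ) : powCoeff b 1 s = b s := by
  simp [powCoeff]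

theorem powCoeff_zero_right (b : ℕ → A) (hb : b 0 = 1) (k : ℕ) : powCoeff b k 0 = 1 := by
  simp [powCoeff, hb, Finset.Nat.antidiagonalTuple_zero_right]

theorem compCoeff_eq_left (a b : ℕ → A) (hb : b 0 = 1) (n : ℕ) :
    compCoeff a b n = ∑ m : Fin n, a m * powCoeff b (m + 1) (n - m) + a n := by
  rw [compCoeff, Finset.sum_range_succ, Finset.sum_range]
  simp [powCoeff_zero_right b hb]

theorem compCoeff_eq_right (a b : ℕ → A) (ha : a 0 = 1) (n : ℕ) :
    compCoeff a b n = b n + ∑ m ∈ Finset.Icc 1 n, a m * powCoeff b (m + 1) (n - m) := by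
  rw [compCoeff, Finset.range_eq_Ico, Finset.sum_eq_sum_Ico_succ_bot (Nat.succ_pos n)]
  simp [powCoeff_one, ha]
  rfl

/-- The right division of coefficient sequences, defined recursively so that `(a / b) ∘ b = a`. -/
def rdivCoeff (a b : ℕ → A) (n : ℕ) : A :=
  a n - ∑ m : Fin n, rdivCoeff a b m * powCoeff b (m + 1) (n - m)
termination_by n
decreasing_by exact m.2

/-- The left division of coefficient sequences, defined recursively so that `a ∘ (a \ b) = b`
(the truncation at `s < n` does not affect the terms of the sum). -/
def ldivCoeff (a b : ℕ → A) (n : ℕ) : A :=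
  b n - ∑ m ∈ Finset.Icc 1 n,
    a m * powCoeff (fun s => if _h : s < n then ldivCoeff a b s else 0) (m + 1) (n - m)
termination_by n

theorem compCoeff_rdivCoeff (a b : ℕ → A) (hb : b 0 = 1) (n : ℕ) :
    compCoeff (rdivCoeff a b) b n = a n := by
  rw [compCoeff_eq_left _ _ hb, rdivCoeff.eq_1 a b n]
  abel

theorem compCoeff_ldivCoeff (a b : ℕ → A) (ha : a 0 = 1) (n : ℕ) :
    compCoeff a (ldivCoeff a b) n = b n := by
  rw [compCoeff_eq_right _ _ ha, ldivCoeff.eq_1 a b n, sub_add_eq_add_sub, sub_eq_iff_eq_add]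
  congr 1
  refine Finset.sum_congr rfl fun m hm => ?_
  rw [Finset.mem_Icc] at hm
  congr 1
  refine powCoeff_congr (fun s hs => ?_) _
  rw [dif_pos (by omega)]

theorem compCoeff_right_cancel (x y b : ℕ → A) (hb : b 0 = 1)
    (h : ∀ n, compCoeff x b n = compCoeff y b n) (n : ℕ) : x n = y n := by
  induction n using Nat.strong_induction_on with
  | _ n ih =>
    have h1 := h n
    rw [compCoeff_eq_left _ _ hb, compCoeff_eq_left _ _ hb,
      Finset.sum_congr rfl fun (m : Fin n) _ => by rw [ih m m.2]] at h1
    exact add_left_cancel h1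

theorem compCoeff_left_cancel (a x y : ℕ → A) (ha : a 0 = 1)
    (h : ∀ n, compCoeff a x n = compCoeff a y n) (n : ℕ) : x n = y n := by
  induction n using Nat.strong_induction_on with
  | _ n ih =>
    have h1 := h n
    rw [compCoeff_eq_right _ _ ha, compCoeff_eq_right _ _ ha,
      Finset.sum_congr rfl fun m hm => by
        rw [powCoeff_congr (fun s hs => ih s (by rw [Finset.mem_Icc] at hm; omega))]] at h1
    exact add_right_cancel h1

/-- The coefficients of the unit series `e = λ`. -/
def unitCoeff (n : ℕ) : A := if n = 0 then 1 else 0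

theorem compCoeff_unit_left (b : ℕ → A) (n : ℕ) : compCoeff unitCoeff b n = b n := by
  rw [compCoeff_eq_right _ _ (by simp [unitCoeff]), Finset.sum_eq_zero, add_zero]
  intro m hm
  rw [Finset.mem_Icc] at hm
  rw [unitCoeff, if_neg (by omega), zero_mul]

theorem compCoeff_unit_right (a : ℕ → A) (n : ℕ) : compCoeff a unitCoeff n = a n := by
  rw [compCoeff_eq_left _ _ (by simp [unitCoeff]), Finset.sum_eq_zero, zero_add]
  rintro ⟨m, hm⟩ -
  have : powCoeff (unitCoeff (A := A)) (m + 1) (n - m) = 0 := by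
    refine Finset.sum_eq_zero fun t ht => ?_
    rw [Finset.Nat.mem_antidiagonalTuple] at ht
    obtain ⟨i, -, hi⟩ := Finset.exists_ne_zero_of_sum_ne_zero (s := Finset.univ) (f := t)
      (by omega)
    refine List.prod_eq_zero ?_
    rw [List.mem_ofFn]
    exact ⟨i, by simp [unitCoeff, hi]⟩
  simp only [this, mul_zero]

/-- `Diff(A)` is a loop, under composition of formal diffeomorphisms. -/
instance : Loop (Diff A) where
  mul a b := ⟨compCoeff a.coeff b.coeff, by
    rw [compCoeff_eq_left _ _ b.coeff_zero]; simp [a.coeff_zero]⟩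
  one := ⟨unitCoeff, by simp [unitCoeff]⟩
  rdiv a b := ⟨rdivCoeff a.coeff b.coeff, by rw [rdivCoeff]; simp [a.coeff_zero]⟩
  ldiv a b := ⟨ldivCoeff a.coeff b.coeff, by rw [ldivCoeff]; simp [b.coeff_zero]⟩
  one_mul' a := Diff.ext (funext fun n => compCoeff_unit_left _ n)
  mul_one' a := Diff.ext (funext fun n => compCoeff_unit_right _ n)
  mul_ldiv a b := Diff.ext (funext fun n => compCoeff_ldivCoeff _ _ a.coeff_zero n)
  ldiv_mul a b := Diff.ext (funext fun n =>
    compCoeff_left_cancel a.coeff _ _ a.coeff_zero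
      (fun n => compCoeff_ldivCoeff _ _ a.coeff_zero n) n)
  rdiv_mul a b := Diff.ext (funext fun n => compCoeff_rdivCoeff _ _ b.coeff_zero n)
  mul_rdiv a b := Diff.ext (funext fun n =>
    compCoeff_right_cancel _ _ b.coeff b.coeff_zero
      (fun n => compCoeff_rdivCoeff _ _ b.coeff_zero n) n)

theorem Diff.mul_coeff (a b : Diff A) (n : ℕ) :
    (a * b).coeff n = compCoeff a.coeff b.coeff n := rfl

/-- A ring homomorphism acts on formal diffeomorphisms coefficientwise. -/
def Diff.map {B : Type u} [Ring B] (f : A →+* B) (a : Diff A) : Diff B :=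
  ⟨fun n => f (a.coeff n), by rw [a.coeff_zero, map_one]⟩

theorem Diff.map_mul {B : Type u} [Ring B] (f : A →+* B) (a b : Diff A) :
    Diff.map f (a * b) = Diff.map f a * Diff.map f b := by
  ext n
  change f (compCoeff a.coeff b.coeff n) = compCoeff (fun n => f (a.coeff n))
    (fun n => f (b.coeff n)) n
  simp only [compCoeff, powCoeff, map_sum, _root_.map_mul, map_list_prod, List.map_ofFn]
  rfl

end Diff

/-- The functor `Diff` from unital associative `F`-algebras to loops. -/
def diffFunctor (F : Type u) [Field F] : AlgCat.{u} F ⥤ LoopCat.{u} where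
  obj A := LoopCat.mk (Diff A)
  map f := ⟨Diff.map f.hom.toRingHom, Diff.map_mul _⟩
  map_id _ := rfl
  map_comp _ _ := rfl

/-! ### Compositions and (labeled) Lagrange coefficients -/

/-- The compositions of `n` of length `ℓ`: sequences `(n_1, …, n_ℓ)` of positive integers with
sum `n`. -/
def compositions (n ℓ : ℕ) : Finset (Fin ℓ → ℕ) :=
  {k ∈ Finset.Nat.antidiagonalTuple ℓ n | ∀ i, 1 ≤ k i}

/-- The sequences `(m_1, …, m_ℓ)` of non-negative integers with `m_1 + ⋯ + m_ℓ = ℓ` and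
`m_1 + ⋯ + m_j ≥ j` for all `j`. -/
def ballot (ℓ : ℕ) : Finset (Fin ℓ → ℕ) :=
  {m ∈ Finset.Nat.antidiagonalTuple ℓ ℓ | ∀ j : Fin ℓ, (j : ℕ) + 1 ≤ ∑ i ∈ Finset.Iic j, m i}

/-- The Lagrange coefficients `d_ℓ(n_1, …, n_ℓ)`; in particular `d_0 = 1`. -/
def lagrangeCoeff {ℓ : ℕ} (n : Fin ℓ → ℕ) : ℕ :=
  ∑ m ∈ ballot ℓ, ∏ i, (n i + 1).choose (m i)

/-- The sequences of `ℓ` bits with values in `{1, 2}`. -/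
def bits (ℓ : ℕ) : Finset (Fin ℓ → ℕ) :=
  Fintype.piFinset fun _ => {1, 2}

/-- The sequences `m` of `ballot ℓ` such that `m_i = 0` whenever `e_i = 2`. -/
def labeledBallot {ℓ : ℕ} (e : Fin ℓ → ℕ) : Finset (Fin ℓ → ℕ) :=
  {m ∈ ballot ℓ | ∀ i, e i = 2 → m i = 0}

/-- The labeled Lagrange coefficients `d_ℓ^e(n_1, …, n_ℓ)`; in particular `d_0^e = 1`. -/
def labeledLagrangeCoeff {ℓ : ℕ} (e n : Fin ℓ → ℕ) : ℕ :=
  ∑ m ∈ labeledBallot e, ∏ i, (n i + 1).choose (m i)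

/-- The sign `(-1)^e = (-1)^(e_1 + ⋯ + e_ℓ - ℓ)`. -/
def bitSign {ℓ : ℕ} (e : Fin ℓ → ℕ) : ℤ :=
  (-1) ^ (∑ i, e i - ℓ)

/-! ### The Faà di Bruno coloop bialgebra -/

section FaaDiBruno

variable (F : Type u) [Field F]

/-- The free unital associative algebra `F⟨x_n, n ≥ 1⟩`. -/
noncomputable abbrev H : AlgCat.{u} F := AlgCat.of F (FreeAlgebra F ℕ+)

/-- The generators `x_n`, with `x_0 = 1`. -/
noncomputable def gen (n : ℕ) : H F :=
  if h : 0 < n then FreeAlgebra.ι F (⟨n, h⟩ : ℕ+) else 1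

variable {F} in
/-- The algebra homomorphism on `F⟨x_n, n ≥ 1⟩` sending `x_n` to `f n` for all `n ≥ 1`. -/
noncomputable def liftGen {A : AlgCat.{u} F} (f : ℕ → A) : H F ⟶ A :=
  AlgCat.ofHom (FreeAlgebra.lift F fun n : ℕ+ => f n)

/-- The generators `x_n = x_n^{(1)}` of the first copy in `H ⨿ H`. -/
noncomputable def genX (n : ℕ) : (H F ⨿ H F : AlgCat.{u} F) :=
  (coprod.inl : H F ⟶ H F ⨿ H F).hom (gen F n)

/-- The generators `y_n = x_n^{(2)}` of the second copy in `H ⨿ H`. -/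
noncomputable def genY (n : ℕ) : (H F ⨿ H F : AlgCat.{u} F) :=
  (coprod.inr : H F ⟶ H F ⨿ H F).hom (gen F n)

/-- The Faà di Bruno comultiplication. -/
noncomputable def comul : H F ⟶ H F ⨿ H F :=
  liftGen fun n => genX F n + genY F n +
    ∑ ℓ ∈ Finset.Icc 1 (n - 1), ∑ k ∈ compositions n (ℓ + 1),
      (k 0 + 1).choose ℓ • (genX F (k 0) * (List.ofFn fun i : Fin ℓ => genY F (k i.succ)).prod)

/-- The counit with values in `F`, `ε(x_n) = 0` for `n ≥ 1`. -/
noncomputable def counitBase : H F ⟶ AlgCat.of F F :=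
  liftGen (A := AlgCat.of F F) fun n => if n = 0 then (1 : F) else 0

/-- The counit with values in the chosen initial algebra. -/
noncomputable def counit : H F ⟶ ⊥_ (AlgCat.{u} F) :=
  counitBase F ≫ (baseIsInitial F).to _

/-- The right codivision. -/
noncomputable def rcodiv : H F ⟶ H F ⨿ H F :=
  liftGen fun n => ∑ ℓ ∈ Finset.range n, (-1 : ℤ) ^ ℓ • ∑ k ∈ compositions n (ℓ + 1),
    lagrangeCoeff (fun i : Fin ℓ => k i.castSucc) •
      ((genX F (k 0) - genY F (k 0)) * (List.ofFn fun i : Fin ℓ => genY F (k i.succ)).prod)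

/-- The left codivision. -/
noncomputable def lcodiv : H F ⟶ H F ⨿ H F :=
  liftGen fun n => ∑ ℓ ∈ Finset.range n, (-1 : ℤ) ^ ℓ • ∑ k ∈ compositions n (ℓ + 1),
    ∑ e ∈ bits ℓ, bitSign e • labeledLagrangeCoeff e (fun i : Fin ℓ => k i.castSucc) •
      ((List.ofFn fun i : Fin ℓ =>
          if e i = 1 then genX F (k i.castSucc) else genY F (k i.castSucc)).prod *
        (genY F (k (Fin.last ℓ)) - genX F (k (Fin.last ℓ))))

end FaaDiBruno

end FdB

/-! Write a series divided by `λ`, so that elements of `Diff A` are power series with constant term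
`1` and a central variable. Composition is additive in its left argument, and expanding `c ^ (k +
1)` around `c = 1` gives `d ∘ c = ∑ m, D m * (c - 1) ^ m`, where `D m` has coefficients `binom (k +
1) m • d k` (`compCoeff_eq_sum_chooseSeries`).

For `c = a \ b` and `L = c - 1`, this turns `a ∘ c = b` into a fixed point equation `L = ∑ m, W m *
L ^ m` with `W 0 = b - a`. Unfolding it always at the leftmost factor gives a sum over plane trees
read in prefix order, that is, over Łukasiewicz words (`coeff_pow_eq_sum_forestSum`). The last
letter of such a word is a leaf and the others form a ballot sequence
(`forestSum_eq_sum_shiftedBallot`). An inner leaf has weight `b - a`, an inner node a multiple of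
`a` only; separating the two contributions produces the labels.

For `a / b`, composition is not associative, but the powers of one series commute, so `(r ∘ b) ∘ c =
r` whenever `b ∘ c = e` (`compCoeff_compCoeff_cancel`). Hence `a / b = a ∘ (b \ e)` and `a / b - e =
(a - b) ∘ (b \ e)`: the same forests, with a special first letter.

Finally `Hom(H, A)` is in bijection with `Diff A`, and the formulas say that convolution along the
co-operations is the loop structure. The coloop identities are then the loop identities at the
universal pair `coprod.inl`, `coprod.inr`. -/

namespace FdB

open PowerSeries
open Finset.HasAntidiagonal (antidiagonal mem_antidiagonal)

/-! ### Coefficients of noncommutative products, Łukasiewicz words and plane forests -/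

section Words

variable {R : Type*} [Semiring R]

theorem coeff_prod_ofFn {ℓ : ℕ} (f : Fin ℓ → R⟦X⟧) (n : ℕ) :
    coeff n (List.ofFn f).prod =
      ∑ k ∈ Finset.Nat.antidiagonalTuple ℓ n, (List.ofFn fun i => coeff (k i) (f i)).prod := by
  induction ℓ generalizing n with
  | zero => cases n <;> simp [coeff_one]
  | succ ℓ ih =>
    rw [List.ofFn_succ, List.prod_cons, coeff_mul]
    simp only [ih, Finset.mul_sum]
    rw [Finset.sum_sigma']
    refine Finset.sum_bij' (fun x _ => Fin.cons x.1.1 x.2)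
      (fun k _ => ⟨(k 0, ∑ i : Fin ℓ, k i.succ), fun i => k i.succ⟩) ?_ ?_ ?_ ?_ ?_
    · rintro ⟨⟨i, j⟩, k⟩ h
      simp only [Finset.mem_sigma, mem_antidiagonal,
        Finset.Nat.mem_antidiagonalTuple] at h ⊢
      simp [Fin.sum_univ_succ, h.1, h.2]
    · intro k h
      simp only [Finset.mem_sigma, mem_antidiagonal,
        Finset.Nat.mem_antidiagonalTuple] at h ⊢
      simp [← h, Fin.sum_univ_succ]
    · rintro ⟨⟨i, j⟩, k⟩ h
      simp only [Finset.mem_sigma, mem_antidiagonal,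
        Finset.Nat.mem_antidiagonalTuple] at h
      simp [h.2]
    · intro k h
      exact Fin.cons_self_tail k
    · rintro ⟨⟨i, j⟩, k⟩ h
      simp [List.ofFn_succ]

theorem coeff_prod_ofFn_compositions {ℓ : ℕ} (f : Fin ℓ → R⟦X⟧) (hf : ∀ i, coeff 0 (f i) = 0)
    (n : ℕ) :
    coeff n (List.ofFn f).prod =
      ∑ k ∈ compositions n ℓ, (List.ofFn fun i => coeff (k i) (f i)).prod := by
  rw [coeff_prod_ofFn, compositions, Finset.sum_filter_of_ne]
  intro k _ h i
  by_contra hi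
  refine h (List.prod_eq_zero ?_)
  rw [List.mem_ofFn]
  exact ⟨i, by rw [show k i = 0 by omega, hf]⟩

/-- The sum, over the Łukasiewicz words of length `ℓ` coding a forest of `p` plane trees, of the
products of the weights `W i m` of the letters, `i` being the position of the letter and `m` its
number of children. -/
def forestSum : (ℕ → ℕ → R) → ℕ → ℕ → R
  | _, 0, p => if p = 0 then 1 else 0
  | _, _ + 1, 0 => 0
  | W, ℓ + 1, p + 1 =>
    ∑ m ∈ Finset.range (ℓ + 1), W 0 m * forestSum (fun i => W (i + 1)) ℓ (p + m)

/-- Each letter completes one vertex, so a forest of `p` trees needs at least `p` letters. -/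
theorem forestSum_eq_zero (W : ℕ → ℕ → R) {ℓ p : ℕ} (h : ℓ < p) : forestSum W ℓ p = 0 := by
  induction ℓ generalizing p W with
  | zero => simp [forestSum, show p ≠ 0 by omega]
  | succ ℓ ih =>
    obtain ⟨p, rfl⟩ : ∃ q, p = q + 1 := ⟨p - 1, by omega⟩
    rw [forestSum]
    exact Finset.sum_eq_zero fun m _ => by rw [ih _ (by omega), mul_zero]

theorem forestSum_succ_succ (W : ℕ → ℕ → R) (ℓ p : ℕ) {N : ℕ} (hN : ℓ < N) :
    forestSum W (ℓ + 1) (p + 1) =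
      ∑ m ∈ Finset.range N, W 0 m * forestSum (fun i => W (i + 1)) ℓ (p + m) := by
  rw [forestSum]
  refine Finset.sum_subset (Finset.range_mono hN) fun m _ hm => ?_
  rw [Finset.mem_range] at hm
  rw [forestSum_eq_zero _ (by omega), mul_zero]

/-- The ballot sequences whose partial sums are shifted by `p`. -/
def shiftedBallot (p ℓ : ℕ) : Finset (Fin ℓ → ℕ) :=
  {m ∈ Fintype.piFinset fun _ => Finset.range (ℓ + 1) |
    p + ∑ i, m i = ℓ ∧ ∀ j : Fin ℓ, (j : ℕ) + 1 ≤ p + ∑ i ∈ Finset.Iic j, m i}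

/-- The box in the definition only provides finiteness: the total bounds every entry by `ℓ`. -/
theorem mem_shiftedBallot {p ℓ : ℕ} {m : Fin ℓ → ℕ} :
    m ∈ shiftedBallot p ℓ ↔
      p + ∑ i, m i = ℓ ∧ ∀ j : Fin ℓ, (j : ℕ) + 1 ≤ p + ∑ i ∈ Finset.Iic j, m i := by
  rw [shiftedBallot, Finset.mem_filter, and_iff_right_iff_imp]
  rintro ⟨h, -⟩
  rw [Fintype.mem_piFinset]
  intro i
  have := Finset.single_le_sum (f := m) (fun _ _ => Nat.zero_le _) (Finset.mem_univ i)
  rw [Finset.mem_range]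
  omega

theorem shiftedBallot_zero_left (ℓ : ℕ) : shiftedBallot 0 ℓ = ballot ℓ := by
  ext m
  simp [mem_shiftedBallot, ballot, Finset.Nat.mem_antidiagonalTuple]

theorem sum_Iic_succ {ℓ : ℕ} (m : Fin (ℓ + 1) → ℕ) (j : Fin ℓ) :
    ∑ i ∈ Finset.Iic j.succ, m i = m 0 + ∑ i ∈ Finset.Iic j, m i.succ := by
  have : Finset.Iic j.succ = insert 0 ((Finset.Iic j).map (Fin.succEmb ℓ)) := by
    ext i
    refine Fin.cases ?_ (fun i => ?_) i <;> simp
  rw [this, Finset.sum_insert (by simp), Finset.sum_map]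
  rfl

/-- Reading a vertex with `m 0` children changes the number of pending vertices by `m 0 - 1`. The
first inequality keeps the natural subtraction exact. -/
theorem mem_shiftedBallot_succ {p ℓ : ℕ} {m : Fin (ℓ + 1) → ℕ} :
    m ∈ shiftedBallot p (ℓ + 1) ↔
      1 ≤ p + m 0 ∧ (fun i : Fin ℓ => m i.succ) ∈ shiftedBallot (p + m 0 - 1) ℓ := by
  have h0 : Finset.Iic (0 : Fin (ℓ + 1)) = {0} := by ext i; simp
  rw [mem_shiftedBallot, mem_shiftedBallot, Fin.forall_fin_succ, Fin.sum_univ_succ]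
  simp only [sum_Iic_succ, h0, Finset.sum_singleton, Fin.val_zero, Fin.val_succ]
  constructor
  · rintro ⟨h1, h2, h3⟩
    exact ⟨by omega, by omega, fun j => by have := h3 j; omega⟩
  · rintro ⟨h1, h2, h3⟩
    exact ⟨by omega, by omega, fun j => by have := h3 j; omega⟩

/-- Before the last letter exactly one vertex is pending, and it must be a leaf: hence the final
`0`. The ballot inequalities say that a vertex is pending before every letter. -/
theorem forestSum_eq_sum_shiftedBallot (W : ℕ → ℕ → R) (ℓ p : ℕ) :
    forestSum W (ℓ + 1) (p + 1) = ∑ m ∈ shiftedBallot p ℓ,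
      (List.ofFn fun i : Fin (ℓ + 1) => W i ((Fin.snoc m 0 : Fin (ℓ + 1) → ℕ) i)).prod := by
  induction ℓ generalizing p W with
  | zero =>
    have : shiftedBallot p 0 = if p = 0 then Finset.univ else ∅ := by
      ext m
      rw [mem_shiftedBallot]
      split_ifs with h
      · exact ⟨fun _ => Finset.mem_univ _, fun _ => ⟨by simp [h], fun j => j.elim0⟩⟩
      · simp [h]
    rw [forestSum, this]
    split_ifs with h <;> simp [forestSum, h, Fin.snoc]
  | succ ℓ ih =>
    have hstep : ∀ m, forestSum (fun i => W (i + 1)) (ℓ + 1) (p + m) =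
        ∑ m' ∈ if 1 ≤ p + m then shiftedBallot (p + m - 1) ℓ else ∅,
          (List.ofFn fun i : Fin (ℓ + 1) =>
            W (i + 1) ((Fin.snoc m' 0 : Fin (ℓ + 1) → ℕ) i)).prod := by
      intro m
      split_ifs with h
      · rw [← ih fun i => W (i + 1)]
        congr 1
        omega
      -- No vertex is pending while letters remain, so there is no such word.
      · rw [show p + m = 0 by omega]
        rfl
    rw [forestSum]
    simp only [hstep, Finset.mul_sum]
    rw [Finset.sum_sigma']
    refine Finset.sum_bij' (fun x _ => Fin.cons x.1 x.2)
      (fun m _ => ⟨m 0, fun i => m i.succ⟩) ?_ ?_ ?_ ?_ ?_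
    · rintro ⟨m, m'⟩ h
      simp only [Finset.mem_sigma] at h
      rw [mem_shiftedBallot_succ]
      split_ifs at h with h'
      · simpa [h'] using h.2
      · simp at h
    · intro m h
      have h1 := (mem_shiftedBallot.1 h).1
      have h2 := Finset.single_le_sum (f := m) (fun _ _ => Nat.zero_le _) (Finset.mem_univ 0)
      rw [mem_shiftedBallot_succ] at h
      simp only [Finset.mem_sigma, Finset.mem_range, if_pos h.1]
      exact ⟨by omega, h.2⟩
    · rintro ⟨m, m'⟩ h
      simp
    · intro m h
      exact Fin.cons_self_tail m
    · rintro ⟨m, m'⟩ h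
      rw [List.ofFn_succ, List.prod_cons, ← Fin.cons_snoc_eq_snoc_cons]
      simp

/-- Prepends a first letter to forest expansions. Since `W 0 m` has no constant term, the expansions
of `P` are only needed below degree `n`. The weights may depend on the position, so that the first
letter can be special, as for the right division. -/
theorem sum_coeff_mul_eq_sum_forestSum {W : ℕ → ℕ → R⟦X⟧} {P : ℕ → R⟦X⟧} {n p N : ℕ}
    (hW : ∀ m, coeff 0 (W 0 m) = 0)
    (hP : ∀ j < n, ∀ m,
      coeff j (P m) = ∑ ℓ ∈ Finset.range N, coeff j (forestSum (fun i => W (i + 1)) ℓ m)) :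
    ∑ m ∈ Finset.range (N + 1), coeff n (W 0 m * P (p + m)) =
      ∑ ℓ ∈ Finset.range N, coeff n (forestSum W (ℓ + 1) (p + 1)) := by
  have h2 : ∀ ℓ ∈ Finset.range N, coeff n (forestSum W (ℓ + 1) (p + 1)) =
      ∑ m ∈ Finset.range (N + 1),
        coeff n (W 0 m * forestSum (fun i => W (i + 1)) ℓ (p + m)) := by
    intro ℓ hℓ
    rw [Finset.mem_range] at hℓ
    rw [forestSum_succ_succ _ ℓ p (N := N + 1) (by omega), map_sum]
  rw [Finset.sum_congr rfl h2, Finset.sum_comm]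
  refine Finset.sum_congr rfl fun m _ => ?_
  simp only [coeff_mul]
  rw [Finset.sum_comm]
  refine Finset.sum_congr rfl fun x hx => ?_
  rw [mem_antidiagonal] at hx
  by_cases h0 : x.1 = 0
  · simp [h0, hW]
  · rw [hP x.2 (by omega), Finset.mul_sum]

/-- A series which satisfies `L = ∑ m, W m * L ^ m` is a sum over plane trees, and its powers are
sums over forests. -/
theorem coeff_pow_eq_sum_forestSum {L : R⟦X⟧} {W : ℕ → R⟦X⟧} (hW : ∀ m, coeff 0 (W m) = 0)
    (hL : ∀ n N, n < N → coeff n L = ∑ m ∈ Finset.range N, coeff n (W m * L ^ m))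
    (n p N : ℕ) (hN : n < N) :
    coeff n (L ^ p) = ∑ ℓ ∈ Finset.range N, coeff n (forestSum (fun _ => W) ℓ p) := by
  induction n using Nat.strong_induction_on generalizing p N with
  | _ n ih =>
    obtain ⟨N, rfl⟩ : ∃ M, N = M + 1 := ⟨N - 1, by omega⟩
    rw [Finset.sum_range_succ']
    cases p with
    | zero => simp [forestSum]
    | succ p =>
      -- Expand only the leftmost factor: the root of the first tree is replaced by its `m`
      -- children.
      have h1 : coeff n (L ^ (p + 1)) =
          ∑ m ∈ Finset.range (N + 1), coeff n (W m * L ^ (p + m)) := by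
        rw [pow_succ', coeff_mul]
        rw [Finset.sum_congr rfl fun x hx => by
          rw [hL x.1 (N + 1) (by
            rw [mem_antidiagonal] at hx; omega), Finset.sum_mul]]
        rw [Finset.sum_comm]
        refine Finset.sum_congr rfl fun m _ => ?_
        rw [← coeff_mul, mul_assoc, ← pow_add, add_comm m p]
      rw [h1, sum_coeff_mul_eq_sum_forestSum (W := fun _ => W) hW fun j hj m => ih j hj m N
        (by omega)]
      simp [forestSum]

end Words

/-! ### Binomial expansion of the composition -/

section Series

variable {A : Type u} [Ring A]

theorem powCoeff_eq_coeff_pow (b : ℕ → A) (k s : ℕ) :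
    powCoeff b k s = coeff s (PowerSeries.mk b ^ k) := by
  rw [← List.prod_replicate, ← List.ofFn_const, coeff_prod_ofFn]
  simp [powCoeff]

theorem coeff_pow_of_lt {L : A⟦X⟧} (hL : coeff 0 L = 0) {n m : ℕ} (h : n < m) :
    coeff n (L ^ m) = 0 := by
  refine coeff_of_lt_order n (lt_of_lt_of_le (Nat.cast_lt.2 h)
    (le_order_pow_of_constantCoeff_eq_zero m ?_))
  rwa [← coeff_zero_eq_constantCoeff_apply]

/-- The series with coefficients `binom (k + 1) m • d k`. -/
def chooseSeries (d : ℕ → A) (m : ℕ) : A⟦X⟧ :=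
  PowerSeries.mk fun k => (k + 1).choose m • d k

theorem coeff_mk_sub_one (c : ℕ → A) (n : ℕ) :
    coeff n (PowerSeries.mk c - 1) = c n - unitCoeff n := by
  rw [map_sub, coeff_mk, coeff_one]
  rfl

theorem compCoeff_eq_sum_chooseSeries (d c : ℕ → A) (hc : c 0 = 1) {n N : ℕ} (hN : n < N) :
    compCoeff d c n =
      ∑ ℓ ∈ Finset.range N, coeff n (chooseSeries d ℓ * (PowerSeries.mk c - 1) ^ ℓ) := by
  have hL : coeff 0 (PowerSeries.mk c - 1) = 0 := by
    simp [coeff_mk_sub_one, unitCoeff, hc]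
  simp only [coeff_mul, Finset.Nat.sum_antidiagonal_eq_sum_range_succ_mk]
  rw [compCoeff, Finset.sum_comm]
  refine Finset.sum_congr rfl fun m hm => ?_
  rw [Finset.mem_range] at hm
  have h1 : PowerSeries.mk c ^ (m + 1) = ∑ ℓ ∈ Finset.range (m + 2),
      (m + 1).choose ℓ • (PowerSeries.mk c - 1) ^ ℓ := by
    conv_lhs => rw [← sub_add_cancel (PowerSeries.mk c) 1]
    rw [(Commute.one_right _).add_pow]
    refine Finset.sum_congr rfl fun ℓ _ => ?_
    rw [one_pow, mul_one, nsmul_eq_mul, Nat.cast_comm]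
  rw [powCoeff_eq_coeff_pow, h1, map_sum, Finset.mul_sum]
  have h2 : ∀ ℓ, d m * coeff (n - m) ((m + 1).choose ℓ • (PowerSeries.mk c - 1) ^ ℓ) =
      coeff m (chooseSeries d ℓ) * coeff (n - m) ((PowerSeries.mk c - 1) ^ ℓ) := by
    intro ℓ
    rw [map_nsmul, chooseSeries, coeff_mk, mul_smul_comm, smul_mul_assoc]
  simp only [h2]
  -- The two cutoffs are interchangeable: beyond `N` the power of `c - 1` has too high an order, and
  -- beyond `m + 1` the binomial coefficient vanishes.
  rcases le_total N (m + 2) with h | h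
  · refine (Finset.sum_subset (Finset.range_mono h) fun ℓ _ hℓ => ?_).symm
    rw [Finset.mem_range] at hℓ
    rw [coeff_pow_of_lt hL (by omega), mul_zero]
  · refine Finset.sum_subset (Finset.range_mono h) fun ℓ _ hℓ => ?_
    rw [Finset.mem_range] at hℓ
    rw [chooseSeries, coeff_mk, Nat.choose_eq_zero_of_lt (by omega), zero_smul, zero_mul]

theorem compCoeff_sub_left (d d' c : ℕ → A) (n : ℕ) :
    compCoeff (fun k => d k - d' k) c n = compCoeff d c n - compCoeff d' c n := by
  simp [compCoeff, sub_mul]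

/-! ### The right inverse property -/

theorem sum_antidiagonal_assoc {M : Type*} [AddCommMonoid M] (f : ℕ → ℕ → ℕ → M) (n : ℕ) :
    ∑ x ∈ antidiagonal n, ∑ y ∈ antidiagonal x.1, f y.1 y.2 x.2 =
      ∑ x ∈ antidiagonal n, ∑ y ∈ antidiagonal x.2, f x.1 y.1 y.2 := by
  rw [Finset.sum_sigma', Finset.sum_sigma']
  refine Finset.sum_bij' (fun x _ => ⟨(x.2.1, x.2.2 + x.1.2), (x.2.2, x.1.2)⟩)
    (fun x _ => ⟨(x.1.1 + x.2.1, x.2.2), (x.1.1, x.2.1)⟩) ?_ ?_ ?_ ?_ ?_ <;>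
  · rintro ⟨⟨i, j⟩, ⟨k, l⟩⟩ h
    simp only [Finset.mem_sigma, mem_antidiagonal] at h
    obtain ⟨h1, h2⟩ := h
    subst h1 h2
    simp [add_assoc]

theorem sum_antidiagonal_unitCoeff_mul (f : ℕ → ℕ → A) (n : ℕ) :
    ∑ x ∈ antidiagonal n, unitCoeff x.1 * f x.1 x.2 = f 0 n := by
  rw [Finset.sum_eq_single_of_mem (0, n) (by simp)]
  · simp [unitCoeff]
  · rintro ⟨i, j⟩ h h'
    rw [mem_antidiagonal] at h
    have : i ≠ 0 := by rintro rfl; exact h' (by simpa using h)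
    simp [unitCoeff, this]

theorem sum_antidiagonal_mul_unitCoeff (f : ℕ → A) (n : ℕ) :
    ∑ x ∈ antidiagonal n, f x.1 * unitCoeff x.2 = f n := by
  rw [Finset.sum_eq_single_of_mem (n, 0) (by simp)]
  · simp [unitCoeff]
  · rintro ⟨i, j⟩ h h'
    rw [mem_antidiagonal] at h
    have : j ≠ 0 := by rintro rfl; exact h' (by simpa using h)
    simp [unitCoeff, this]

/-- The coefficients of the substitution `λ ↦ c` in the series `p`, multiplied on the right by
`c ^ m / λ ^ m`. -/
def substCoeff (p c : ℕ → A) (m n : ℕ) : A :=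
  ∑ x ∈ antidiagonal n, p x.1 * powCoeff c (m + x.1) x.2

theorem substCoeff_one (p c : ℕ → A) : substCoeff p c 1 = compCoeff p c := by
  funext n
  rw [substCoeff, Finset.Nat.sum_antidiagonal_eq_sum_range_succ_mk, compCoeff]
  simp only [add_comm 1]

theorem powCoeff_add (c : ℕ → A) (k l s : ℕ) : powCoeff c (k + l) s =
    ∑ x ∈ antidiagonal s, powCoeff c k x.1 * powCoeff c l x.2 := by
  simp only [powCoeff_eq_coeff_pow, pow_add, coeff_mul]

theorem powCoeff_zero_left (c : ℕ → A) : powCoeff c 0 = unitCoeff := by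
  funext n
  rw [powCoeff_eq_coeff_pow, pow_zero, coeff_one]
  rfl

/-- Powers of `c` commute, so `c ^ (m + 1 + u + v)` splits as `c ^ (1 + v) * c ^ (m + u)`. The first
factor stands next to `b v`, and summing over `v` gives `b ∘ c = e`. -/
theorem substCoeff_mul (p b c : ℕ → A) (h : compCoeff b c = unitCoeff) (m n : ℕ) :
    substCoeff (fun i => ∑ x ∈ antidiagonal i, p x.1 * b x.2) c (m + 1) n =
      substCoeff p c m n := by
  simp only [substCoeff, Finset.sum_mul]
  have h1 : ∀ x ∈ antidiagonal n, ∀ y ∈ antidiagonal x.1,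
      p y.1 * b y.2 * powCoeff c (m + 1 + x.1) x.2 =
        p y.1 * b y.2 * powCoeff c (m + 1 + (y.1 + y.2)) x.2 := by
    intro x _ y hy
    rw [mem_antidiagonal.1 hy]
  rw [Finset.sum_congr rfl fun x hx => Finset.sum_congr rfl (h1 x hx),
    sum_antidiagonal_assoc fun u v w => p u * b v * powCoeff c (m + 1 + (u + v)) w]
  refine Finset.sum_congr rfl fun x _ => ?_
  rw [← sum_antidiagonal_unitCoeff_mul (fun _ => powCoeff c (m + x.1)) x.2, ← h, ← substCoeff_one]
  simp only [substCoeff, Finset.sum_mul, mul_assoc]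
  rw [sum_antidiagonal_assoc fun u v w => b u * (powCoeff c (1 + u) v * powCoeff c (m + x.1) w),
    Finset.mul_sum]
  refine Finset.sum_congr rfl fun y _ => ?_
  rw [← Finset.mul_sum, ← powCoeff_add]
  congr 3
  ring

theorem substCoeff_powCoeff (b c : ℕ → A) (h : compCoeff b c = unitCoeff) (m : ℕ) :
    substCoeff (powCoeff b m) c m = unitCoeff := by
  funext n
  induction m with
  | zero =>
    rw [powCoeff_zero_left, substCoeff, sum_antidiagonal_unitCoeff_mul fun u v => powCoeff c (0 + u) v,
      add_zero, powCoeff_zero_left]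
  | succ m ih =>
    rw [← ih, ← substCoeff_mul (powCoeff b m) b c h]
    congr 1
    funext i
    simp [powCoeff_add, powCoeff_one]

/-- The right inverse property of the loop of formal diffeomorphisms. -/
theorem compCoeff_compCoeff_cancel (r b c : ℕ → A) (h : compCoeff b c = unitCoeff) :
    compCoeff (compCoeff r b) c = r := by
  funext n
  rw [← substCoeff_one, ← substCoeff_one r b]
  simp only [substCoeff, Finset.sum_mul]
  have h1 : ∀ x ∈ antidiagonal n, ∀ y ∈ antidiagonal x.1,
      r y.1 * powCoeff b (1 + y.1) y.2 * powCoeff c (1 + x.1) x.2 =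
        r y.1 * (powCoeff b (1 + y.1) y.2 * powCoeff c (1 + y.1 + y.2) x.2) := by
    intro x _ y hy
    rw [← mem_antidiagonal.1 hy, mul_assoc, add_assoc]
  rw [Finset.sum_congr rfl fun x hx => Finset.sum_congr rfl (h1 x hx), sum_antidiagonal_assoc
    fun u v w => r u * (powCoeff b (1 + u) v * powCoeff c (1 + u + v) w)]
  simp only [← Finset.mul_sum]
  -- For each index `u` of `r`, the inner sum substitutes `c` into `b ^ (1 + u)`, with the extra
  -- power `1 + u` of `c`; it is the unit.
  rw [← sum_antidiagonal_mul_unitCoeff r n]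
  refine Finset.sum_congr rfl fun x _ => ?_
  rw [← substCoeff_powCoeff b c h (1 + x.1)]
  rfl

theorem rdivCoeff_eq_compCoeff (a b : ℕ → A) (hb : b 0 = 1) :
    rdivCoeff a b = compCoeff a (ldivCoeff b unitCoeff) := by
  conv_rhs => rw [← funext (compCoeff_rdivCoeff a b hb)]
  exact (compCoeff_compCoeff_cancel _ _ _ (funext (compCoeff_ldivCoeff b unitCoeff hb))).symm

/-! ### The divisions as sums over plane trees -/

/-- The weights of the letters for the left division `a \ b`. -/
def ldivWeight (a b : ℕ → A) (m : ℕ) : A⟦X⟧ :=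
  if m = 0 then PowerSeries.mk fun k => b k - a k
  else -chooseSeries (fun k => a k - unitCoeff k) m

theorem coeff_ldivWeight_zero (a b : ℕ → A) (ha : a 0 = 1) (hb : b 0 = 1) (m : ℕ) :
    coeff 0 (ldivWeight a b m) = 0 := by
  unfold ldivWeight
  split_ifs <;> simp [chooseSeries, ha, hb, unitCoeff]

theorem ldivCoeff_zero (a b : ℕ → A) (hb : b 0 = 1) : ldivCoeff a b 0 = 1 := by
  rw [ldivCoeff]
  simp [hb]

/-- With `c = a \ b`, left additivity gives `(a - e) ∘ c = b - c`. Expanding and solving for `c -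
e`, the term `m = 0` combines with `b` into `b - a`. Using `a - e` instead of `a` removes the
constant terms of the weights. -/
theorem coeff_ldivCoeff_eq_sum (a b : ℕ → A) (ha : a 0 = 1) (hb : b 0 = 1) (n N : ℕ)
    (hN : n < N) :
    coeff n (PowerSeries.mk (ldivCoeff a b) - 1) = ∑ m ∈ Finset.range N,
      coeff n (ldivWeight a b m * (PowerSeries.mk (ldivCoeff a b) - 1) ^ m) := by
  have h1 := compCoeff_eq_sum_chooseSeries (fun k => a k - unitCoeff k) (ldivCoeff a b)
    (ldivCoeff_zero a b hb) hN
  obtain ⟨N, rfl⟩ : ∃ M, N = M + 1 := ⟨N - 1, by omega⟩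
  rw [compCoeff_sub_left, compCoeff_unit_left, compCoeff_ldivCoeff a b ha,
    Finset.sum_range_succ', sub_eq_iff_eq_add] at h1
  rw [Finset.sum_range_succ', coeff_mk_sub_one]
  simp only [ldivWeight, Nat.add_eq_zero_iff, one_ne_zero, and_false, if_false, if_true, neg_mul,
    map_neg, Finset.sum_neg_distrib, pow_zero, mul_one, coeff_mk, chooseSeries, h1,
    Nat.choose_zero_right, one_smul]
  abel

theorem coeff_ldivCoeff_pow (a b : ℕ → A) (ha : a 0 = 1) (hb : b 0 = 1) {n N : ℕ} (p : ℕ)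
    (hN : n < N) :
    coeff n ((PowerSeries.mk (ldivCoeff a b) - 1) ^ p) =
      ∑ ℓ ∈ Finset.range N, coeff n (forestSum (fun _ => ldivWeight a b) ℓ p) :=
  coeff_pow_eq_sum_forestSum (coeff_ldivWeight_zero a b ha hb)
    (coeff_ldivCoeff_eq_sum a b ha hb) n p N hN

theorem coeff_forestSum_one (W : ℕ → ℕ → A⟦X⟧) (hW : ∀ i m, coeff 0 (W i m) = 0) (ℓ n : ℕ) :
    coeff n (forestSum W (ℓ + 1) 1) = ∑ k ∈ compositions n (ℓ + 1), ∑ m ∈ ballot ℓ,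
      (List.ofFn fun i : Fin (ℓ + 1) =>
        coeff (k i) (W i ((Fin.snoc m 0 : Fin (ℓ + 1) → ℕ) i))).prod := by
  rw [forestSum_eq_sum_shiftedBallot, shiftedBallot_zero_left, map_sum, Finset.sum_comm]
  exact Finset.sum_congr rfl fun m _ => coeff_prod_ofFn_compositions _ (fun i => hW _ _) n

theorem ldivCoeff_eq_sum_forestSum (a b : ℕ → A) (ha : a 0 = 1) (hb : b 0 = 1) {n : ℕ}
    (hn : 1 ≤ n) :
    ldivCoeff a b n =
      ∑ ℓ ∈ Finset.range n, coeff n (forestSum (fun _ => ldivWeight a b) (ℓ + 1) 1) := by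
  have h := coeff_ldivCoeff_pow a b ha hb 1 (Nat.lt_succ_self n)
  rw [pow_one, coeff_mk_sub_one, unitCoeff, if_neg (by omega), sub_zero,
    Finset.sum_range_succ'] at h
  simpa [forestSum] using h

/-- The weights of the letters for the right division `a / b`. -/
def rdivWeight (a b : ℕ → A) : ℕ → ℕ → A⟦X⟧
  | 0 => chooseSeries fun k => a k - b k
  | _ + 1 => ldivWeight b unitCoeff

theorem rdivCoeff_eq_sum_forestSum (a b : ℕ → A) (ha : a 0 = 1) (hb : b 0 = 1) {n : ℕ}
    (hn : 1 ≤ n) :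
    rdivCoeff a b n =
      ∑ ℓ ∈ Finset.range n, coeff n (forestSum (rdivWeight a b) (ℓ + 1) 1) := by
  have he : (unitCoeff 0 : A) = 1 := by simp [unitCoeff]
  have h := compCoeff_eq_sum_chooseSeries (fun k => a k - b k) (ldivCoeff b unitCoeff)
    (ldivCoeff_zero b _ he) (Nat.lt_succ_self n)
  -- This is `(a - b) ∘ (b \ e) = a / b - e`, whose unit term vanishes in degree `n ≥ 1`.
  rw [compCoeff_sub_left, compCoeff_ldivCoeff b _ hb, ← rdivCoeff_eq_compCoeff a b hb, unitCoeff,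
    if_neg (by omega), sub_zero] at h
  rw [h, ← sum_coeff_mul_eq_sum_forestSum (W := rdivWeight a b) (p := 0)
    (P := fun m => (PowerSeries.mk (ldivCoeff b unitCoeff) - 1) ^ m)]
  · simp [rdivWeight]
  · simp [rdivWeight, chooseSeries, ha, hb]
  · intro j hj m
    exact coeff_ldivCoeff_pow b unitCoeff hb he m hj

/-! ### The explicit formulas -/

theorem prod_ofFn_smul {ℓ : ℕ} (c : Fin ℓ → ℤ) (x : Fin ℓ → A) :
    (List.ofFn fun i => c i • x i).prod = (∏ i, c i) • (List.ofFn x).prod :=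
  (MultilinearMap.mkPiAlgebraFin ℤ ℓ A).map_smul_univ c x

theorem prod_ofFn_sum {ℓ : ℕ} (s : Finset ℕ) (f : Fin ℓ → ℕ → A) :
    (List.ofFn fun i => ∑ e ∈ s, f i e).prod =
      ∑ e ∈ Fintype.piFinset fun _ => s, (List.ofFn fun i => f i (e i)).prod :=
  (MultilinearMap.mkPiAlgebraFin ℤ ℓ A).map_sum_finset f fun _ => s

theorem one_le_of_mem_compositions {n ℓ : ℕ} {k : Fin ℓ → ℕ} (h : k ∈ compositions n ℓ)
    (i : Fin ℓ) : 1 ≤ k i :=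
  (Finset.mem_filter.1 h).2 i

/-- Label `1` selects `a` and label `2` selects `b`, which only a leaf can contribute. The guard is
the condition defining `labeledBallot`; the common factor `-1` is set apart to build `(-1) ^ ℓ`. -/
theorem coeff_ldivWeight (a b : ℕ → A) {k : ℕ} (hk : 1 ≤ k) (m : ℕ) :
    coeff k (ldivWeight a b m) = ∑ e ∈ ({1, 2} : Finset ℕ),
      (-1 * ((-1) ^ (e - 1) * if e = 2 → m = 0 then ((k + 1).choose m : ℤ) else 0)) •
        if e = 1 then a k else b k := by
  have : k ≠ 0 := by omega
  rw [Finset.sum_pair (by norm_num), ldivWeight]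
  split_ifs <;> simp_all [chooseSeries, unitCoeff, sub_eq_neg_add]

theorem bitSign_eq_prod {ℓ : ℕ} {e : Fin ℓ → ℕ} (he : e ∈ bits ℓ) :
    bitSign e = ∏ i, (-1) ^ (e i - 1) := by
  have h : ∀ i, 1 ≤ e i := by
    intro i
    have := Fintype.mem_piFinset.1 he i
    simp only [Finset.mem_insert, Finset.mem_singleton] at this
    omega
  rw [bitSign, Finset.prod_pow_eq_pow_sum, Finset.sum_tsub_distrib _ fun i _ => h i]
  simp

theorem sum_ballot_prod_ldivWeight (a b : ℕ → A) {ℓ : ℕ} {k : Fin ℓ → ℕ} (hk : ∀ i, 1 ≤ k i) :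
    ∑ m ∈ ballot ℓ, (List.ofFn fun i => coeff (k i) (ldivWeight a b (m i))).prod =
      (-1 : ℤ) ^ ℓ • ∑ e ∈ bits ℓ, bitSign e • labeledLagrangeCoeff e k •
        (List.ofFn fun i => if e i = 1 then a (k i) else b (k i)).prod := by
  simp only [fun m : Fin ℓ → ℕ => fun i => coeff_ldivWeight a b (hk i) (m i), prod_ofFn_sum,
    prod_ofFn_smul]
  rw [Finset.sum_comm, Finset.smul_sum]
  refine Finset.sum_congr rfl fun e he => ?_
  rw [← Finset.sum_smul, ← Nat.cast_smul_eq_nsmul ℤ, smul_smul, smul_smul]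
  congr 1
  rw [bitSign_eq_prod he, labeledLagrangeCoeff, labeledBallot, Finset.sum_filter]
  push_cast
  simp only [Finset.mul_sum]
  refine Finset.sum_congr rfl fun m _ => ?_
  -- The three factors become `(-1) ^ ℓ`, the sign of the labels, and a single guard restricting the
  -- ballot sequences.
  rw [Finset.prod_mul_distrib, Finset.prod_mul_distrib, Fintype.prod_ite_zero]
  simp [mul_assoc]

theorem ldivCoeff_eq_sum (a b : ℕ → A) (ha : a 0 = 1) (hb : b 0 = 1) {n : ℕ} (hn : 1 ≤ n) :
    ldivCoeff a b n =
      ∑ ℓ ∈ Finset.range n, (-1 : ℤ) ^ ℓ • ∑ k ∈ compositions n (ℓ + 1),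
        ∑ e ∈ bits ℓ, bitSign e • labeledLagrangeCoeff e (fun i : Fin ℓ => k i.castSucc) •
          ((List.ofFn fun i : Fin ℓ =>
              if e i = 1 then a (k i.castSucc) else b (k i.castSucc)).prod *
            (b (k (Fin.last ℓ)) - a (k (Fin.last ℓ)))) := by
  rw [ldivCoeff_eq_sum_forestSum a b ha hb hn]
  refine Finset.sum_congr rfl fun ℓ _ => ?_
  rw [coeff_forestSum_one _ fun _ => coeff_ldivWeight_zero a b ha hb, Finset.smul_sum]
  refine Finset.sum_congr rfl fun k hk => ?_
  simp only [List.ofFn_succ', List.concat_eq_append, List.prod_append, List.prod_singleton,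
    Fin.snoc_castSucc, Fin.snoc_last]
  rw [← Finset.sum_mul, sum_ballot_prod_ldivWeight a b (k := fun i => k i.castSucc)
    fun i => one_le_of_mem_compositions hk _]
  simp only [ldivWeight, if_true, coeff_mk, smul_mul_assoc, Finset.sum_mul]

theorem coeff_rdivWeight (a b : ℕ → A) {k : ℕ} (hk : 1 ≤ k) (i m : ℕ) :
    coeff k (rdivWeight a b i m) = ((if i = 0 then 1 else -1) * ((k + 1).choose m : ℤ)) •
      if i = 0 then a k - b k else b k := by
  have : k ≠ 0 := by omega
  cases i with
  | zero => simp [rdivWeight, chooseSeries]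
  | succ i =>
    simp only [rdivWeight, ldivWeight]
    split_ifs <;> simp_all [chooseSeries, unitCoeff]

theorem coeff_rdivWeight_zero (a b : ℕ → A) (ha : a 0 = 1) (hb : b 0 = 1) (i m : ℕ) :
    coeff 0 (rdivWeight a b i m) = 0 := by
  cases i with
  | zero => simp [rdivWeight, chooseSeries, ha, hb]
  | succ i => exact coeff_ldivWeight_zero _ _ hb (by simp [unitCoeff]) m

theorem rdivCoeff_eq_sum (a b : ℕ → A) (ha : a 0 = 1) (hb : b 0 = 1) {n : ℕ} (hn : 1 ≤ n) :
    rdivCoeff a b n =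
      ∑ ℓ ∈ Finset.range n, (-1 : ℤ) ^ ℓ • ∑ k ∈ compositions n (ℓ + 1),
        lagrangeCoeff (fun i : Fin ℓ => k i.castSucc) •
          ((a (k 0) - b (k 0)) * (List.ofFn fun i : Fin ℓ => b (k i.succ)).prod) := by
  rw [rdivCoeff_eq_sum_forestSum a b ha hb hn]
  refine Finset.sum_congr rfl fun ℓ _ => ?_
  rw [coeff_forestSum_one _ (coeff_rdivWeight_zero a b ha hb), Finset.smul_sum]
  refine Finset.sum_congr rfl fun k hk => ?_
  simp only [fun (m : Fin ℓ → ℕ) (i : Fin (ℓ + 1)) => coeff_rdivWeight a b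
    (one_le_of_mem_compositions hk i) i ((Fin.snoc m 0 : Fin (ℓ + 1) → ℕ) i), prod_ofFn_smul]
  rw [← Finset.sum_smul, ← Nat.cast_smul_eq_nsmul ℤ, smul_smul]
  congr 1
  · rw [lagrangeCoeff]
    push_cast
    rw [Finset.mul_sum]
    refine Finset.sum_congr rfl fun m _ => ?_
    -- The signs are split at the first letter, which carries `+1`, and the binomials at the last
    -- one, a leaf with binomial `1`.
    rw [Finset.prod_mul_distrib, Fin.prod_univ_succ, Fin.prod_univ_castSucc (n := ℓ)]
    simp
  · simp [List.ofFn_succ]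

theorem sum_range_eq_add_sum_Icc {M : Type*} [AddCommMonoid M] (f : ℕ → M) {n : ℕ}
    (hn : 1 ≤ n) : ∑ ℓ ∈ Finset.range n, f ℓ = f 0 + ∑ ℓ ∈ Finset.Icc 1 (n - 1), f ℓ := by
  rw [Finset.range_eq_Ico, Finset.sum_eq_sum_Ico_succ_bot (by omega)]
  obtain ⟨n, rfl⟩ : ∃ m, n = m + 1 := ⟨n - 1, by omega⟩
  rfl

theorem sum_compositions_one {M : Type*} [AddCommMonoid M] (f : (Fin 1 → ℕ) → M) {n : ℕ}
    (hn : 1 ≤ n) : ∑ k ∈ compositions n 1, f k = f fun _ => n := by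
  have : compositions n 1 = {fun _ => n} := by
    ext k
    simp only [compositions, Finset.mem_filter, Finset.Nat.mem_antidiagonalTuple,
      Finset.mem_singleton, funext_iff, Fin.forall_fin_one, Fin.sum_univ_one]
    omega
  rw [this, Finset.sum_singleton]

theorem compositions_eq_empty {n ℓ : ℕ} (h : n < ℓ) : compositions n ℓ = ∅ := by
  refine Finset.eq_empty_of_forall_notMem fun k hk => ?_
  have h1 := Finset.sum_le_sum fun i (_ : i ∈ Finset.univ) => one_le_of_mem_compositions hk i
  have h2 := Finset.Nat.mem_antidiagonalTuple.1 (Finset.mem_filter.1 hk).1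
  simp only [Finset.sum_const, Finset.card_univ, Fintype.card_fin, smul_eq_mul, mul_one] at h1
  omega

/-- The explicit form of the composition. -/
theorem compCoeff_eq_sum (a b : ℕ → A) (ha : a 0 = 1) (hb : b 0 = 1) {n : ℕ} (hn : 1 ≤ n) :
    compCoeff a b n = a n + b n +
      ∑ ℓ ∈ Finset.Icc 1 (n - 1), ∑ k ∈ compositions n (ℓ + 1),
        (k 0 + 1).choose ℓ • (a (k 0) * (List.ofFn fun i : Fin ℓ => b (k i.succ)).prod) := by
  have h := compCoeff_eq_sum_chooseSeries (fun k => a k - unitCoeff k) b hb (Nat.lt_succ_self n)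
  have hterm : ∀ ℓ, coeff n (chooseSeries (fun k => a k - unitCoeff k) ℓ *
      (PowerSeries.mk b - 1) ^ ℓ) = ∑ k ∈ compositions n (ℓ + 1),
        (k 0 + 1).choose ℓ • (a (k 0) * (List.ofFn fun i : Fin ℓ => b (k i.succ)).prod) := by
    intro ℓ
    have h1 : chooseSeries (fun k => a k - unitCoeff k) ℓ * (PowerSeries.mk b - 1) ^ ℓ =
        (List.ofFn (Fin.cons (chooseSeries (fun k => a k - unitCoeff k) ℓ)
          fun _ : Fin ℓ => PowerSeries.mk b - 1 : Fin (ℓ + 1) → A⟦X⟧)).prod := by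
      simp [List.ofFn_succ]
    rw [h1, coeff_prod_ofFn_compositions]
    · refine Finset.sum_congr rfl fun k hk => ?_
      have hk0 : ∀ i, k i ≠ 0 := fun i => by have := one_le_of_mem_compositions hk i; omega
      rw [List.ofFn_succ, List.prod_cons]
      simp only [Fin.cons_zero, Fin.cons_succ, chooseSeries, coeff_mk, coeff_mk_sub_one,
        unitCoeff, hk0, if_false, sub_zero, smul_mul_assoc]
    · intro i
      refine Fin.cases ?_ (fun i => ?_) i
      · simp [chooseSeries, ha, unitCoeff]
      · simp [hb]
  simp only [hterm] at h
  -- The term `ℓ = n` is empty, as `n` has no composition into `n + 1` parts, and `ℓ = 0` gives `a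
  -- n`.
  rw [compCoeff_sub_left, compCoeff_unit_left, sub_eq_iff_eq_add, Finset.sum_range_succ,
    compositions_eq_empty (Nat.lt_succ_self n), Finset.sum_empty, add_zero,
    sum_range_eq_add_sum_Icc _ hn, sum_compositions_one _ hn] at h
  rw [h, add_right_comm]
  simp

end Series

/-! ### Homomorphisms from `H` as formal diffeomorphisms, and the coloop structure -/

section Representability

variable {F : Type u} [Field F]

theorem gen_zero : gen F 0 = 1 := by
  simp [gen]

theorem gen_coe (n : ℕ+) : gen F n = FreeAlgebra.ι F n :=
  dif_pos n.2

theorem liftGen_gen {A : AlgCat.{u} F} (f : ℕ → A) {n : ℕ} (hn : 1 ≤ n) :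
    (liftGen f).hom (gen F n) = f n := by
  lift n to ℕ+ using hn
  rw [gen_coe]
  exact FreeAlgebra.lift_ι_apply _ _

theorem hom_ext_gen {A : AlgCat.{u} F} {α β : H F ⟶ A}
    (h : ∀ n, 1 ≤ n → α.hom (gen F n) = β.hom (gen F n)) : α = β := by
  apply AlgCat.hom_ext
  apply FreeAlgebra.hom_ext
  funext n
  have h1 := h n n.2
  rwa [gen_coe] at h1

/-- The formal diffeomorphism `∑ α(x_n) λ^(n+1)` associated to an algebra homomorphism `α`. -/
noncomputable def Diff.ofHom {A : AlgCat.{u} F} (α : H F ⟶ A) : Diff A :=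
  ⟨fun n => α.hom (gen F n), by rw [gen_zero, map_one]⟩

theorem Diff.ofHom_injective {A : AlgCat.{u} F} :
    Function.Injective (Diff.ofHom : (H F ⟶ A) → Diff A) :=
  fun _ _ h => hom_ext_gen fun n _ => congrFun (congrArg Diff.coeff h) n

theorem Diff.ofHom_liftGen {A : AlgCat.{u} F} (a : Diff A) : Diff.ofHom (liftGen a.coeff) = a := by
  ext n
  rcases Nat.eq_zero_or_pos n with rfl | hn
  · rw [Diff.coeff_zero, Diff.coeff_zero]
  · exact liftGen_gen _ hn

theorem Diff.ext_of_pos {A : Type u} [Ring A] {a b : Diff A}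
    (h : ∀ n, 1 ≤ n → a.coeff n = b.coeff n) : a = b := by
  ext n
  rcases Nat.eq_zero_or_pos n with rfl | hn
  · rw [a.coeff_zero, b.coeff_zero]
  · exact h n hn

theorem desc_genX {A : AlgCat.{u} F} (α β : H F ⟶ A) (n : ℕ) :
    (coprod.desc α β).hom (genX F n) = (Diff.ofHom α).coeff n := by
  change (coprod.inl ≫ coprod.desc α β).hom (gen F n) = _
  rw [coprod.inl_desc]
  rfl

theorem desc_genY {A : AlgCat.{u} F} (α β : H F ⟶ A) (n : ℕ) :
    (coprod.desc α β).hom (genY F n) = (Diff.ofHom β).coeff n := by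
  change (coprod.inr ≫ coprod.desc α β).hom (gen F n) = _
  rw [coprod.inr_desc]
  rfl

theorem conv_liftGen_gen {A : AlgCat.{u} F} (f : ℕ → (H F ⨿ H F : AlgCat.{u} F)) (α β : H F ⟶ A)
    {n : ℕ} (hn : 1 ≤ n) :
    (conv (liftGen f) α β).hom (gen F n) = (coprod.desc α β).hom (f n) := by
  rw [conv_eq_desc, ← liftGen_gen f hn]
  rfl

theorem Diff.ofHom_conv_comul {A : AlgCat.{u} F} (α β : H F ⟶ A) :
    Diff.ofHom (conv (comul F) α β) = Diff.ofHom α * Diff.ofHom β := by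
  refine Diff.ext_of_pos fun n hn => ?_
  rw [Diff.mul_coeff, compCoeff_eq_sum _ _ (Diff.coeff_zero _) (Diff.coeff_zero _) hn]
  refine (conv_liftGen_gen _ α β hn).trans ?_
  simp only [map_add, map_sum, map_nsmul, _root_.map_mul, map_list_prod, List.map_ofFn,
    Function.comp_def, desc_genX, desc_genY]

theorem Diff.ofHom_conv_rcodiv {A : AlgCat.{u} F} (α β : H F ⟶ A) :
    Diff.ofHom (conv (rcodiv F) α β) = Loop.rdiv (Diff.ofHom α) (Diff.ofHom β) := by
  refine Diff.ext_of_pos fun n hn => ?_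
  refine Eq.trans ?_ (rdivCoeff_eq_sum _ _ (Diff.coeff_zero _) (Diff.coeff_zero _) hn).symm
  refine (conv_liftGen_gen _ α β hn).trans ?_
  simp only [map_sub, map_sum, map_nsmul, map_zsmul, _root_.map_mul, map_list_prod, List.map_ofFn,
    Function.comp_def, desc_genX, desc_genY]

theorem Diff.ofHom_conv_lcodiv {A : AlgCat.{u} F} (α β : H F ⟶ A) :
    Diff.ofHom (conv (lcodiv F) α β) = Loop.ldiv (Diff.ofHom α) (Diff.ofHom β) := by
  refine Diff.ext_of_pos fun n hn => ?_
  refine Eq.trans ?_ (ldivCoeff_eq_sum _ _ (Diff.coeff_zero _) (Diff.coeff_zero _) hn).symm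
  refine (conv_liftGen_gen _ α β hn).trans ?_
  simp only [map_sub, map_sum, map_nsmul, map_zsmul, _root_.map_mul, map_list_prod, List.map_ofFn,
    Function.comp_def, apply_ite, desc_genX, desc_genY]

theorem Diff.ofHom_counit {A : AlgCat.{u} F} (f : ⊥_ (AlgCat.{u} F) ⟶ A) :
    Diff.ofHom (counit F ≫ f) = 1 := by
  refine Diff.ext_of_pos fun n hn => ?_
  change ((baseIsInitial F).to _ ≫ f).hom ((counitBase F).hom (gen F n)) = unitCoeff n
  rw [counitBase, liftGen_gen (A := AlgCat.of F F) _ hn, if_neg (by omega), unitCoeff,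
    if_neg (by omega)]
  exact map_zero _

/-- A Yoneda reduction: the cocancellation composite is an iterated convolution of the universal
pair, so the identity can be checked in the loop `Diff (H ⨿ H)`. -/
theorem map_associator_hom_eq_conv {C : Type u} [Category.{v} C] [HasBinaryCoproducts C] {X : C}
    (γ δ : X ⟶ X ⨿ X) :
    γ ≫ coprod.map δ (𝟙 X) ≫ (coprod.associator X X X).hom ≫ coprod.map (𝟙 X) (codiag X) =
      conv γ (conv δ coprod.inl coprod.inr) coprod.inr := by
  rw [conv_eq_desc, conv_eq_desc]
  congr 1
  apply coprod.hom_ext <;> simp [coprod.inl_desc, coprod.inr_desc]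

theorem map_associator_inv_eq_conv {C : Type u} [Category.{v} C] [HasBinaryCoproducts C] {X : C}
    (γ δ : X ⟶ X ⨿ X) :
    γ ≫ coprod.map (𝟙 X) δ ≫ (coprod.associator X X X).inv ≫ coprod.map (codiag X) (𝟙 X) =
      conv γ coprod.inl (conv δ coprod.inl coprod.inr) := by
  rw [conv_eq_desc, conv_eq_desc]
  congr 1
  apply coprod.hom_ext <;> simp [coprod.inl_desc, coprod.inr_desc]

variable (F) in
/-- The Faà di Bruno coloop bialgebra. -/
noncomputable def faaDiBruno : Coloop (H F) where
  comul := comul F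
  counit := counit F
  rcodiv := rcodiv F
  lcodiv := lcodiv F
  counit_left := by
    apply Diff.ofHom_injective
    have h : comul F ≫ coprod.map (counit F) (𝟙 (H F)) =
        conv (comul F) (counit F ≫ coprod.inl) coprod.inr := by
      rw [conv_eq_desc]
      congr 1
      apply coprod.hom_ext <;> simp [coprod.inl_desc, coprod.inr_desc]
    rw [h, Diff.ofHom_conv_comul, Diff.ofHom_counit, Loop.one_mul']
  counit_right := by
    apply Diff.ofHom_injective
    have h : comul F ≫ coprod.map (𝟙 (H F)) (counit F) =
        conv (comul F) coprod.inl (counit F ≫ coprod.inr) := by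
      rw [conv_eq_desc]
      congr 1
      apply coprod.hom_ext <;> simp [coprod.inl_desc, coprod.inr_desc]
    rw [h, Diff.ofHom_conv_comul, Diff.ofHom_counit, Loop.mul_one']
  rcodiv_comul := by
    apply Diff.ofHom_injective
    rw [map_associator_hom_eq_conv, Diff.ofHom_conv_comul, Diff.ofHom_conv_rcodiv, Loop.rdiv_mul]
  comul_rcodiv := by
    apply Diff.ofHom_injective
    rw [map_associator_hom_eq_conv, Diff.ofHom_conv_rcodiv, Diff.ofHom_conv_comul, Loop.mul_rdiv]
  lcodiv_comul := by
    apply Diff.ofHom_injective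
    rw [map_associator_inv_eq_conv, Diff.ofHom_conv_comul, Diff.ofHom_conv_lcodiv, Loop.mul_ldiv]
  comul_lcodiv := by
    apply Diff.ofHom_injective
    rw [map_associator_inv_eq_conv, Diff.ofHom_conv_lcodiv, Diff.ofHom_conv_comul, Loop.ldiv_mul]

theorem Diff.ofHom_comp {A B : AlgCat.{u} F} (α : H F ⟶ A) (f : A ⟶ B) :
    Diff.ofHom (α ≫ f) = Diff.map f.hom.toRingHom (Diff.ofHom α) :=
  rfl

variable (F) in
/-- The Faà di Bruno coloop bialgebra represents the functor of formal diffeomorphisms. -/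
noncomputable def functorIsoDiff : (faaDiBruno F).functor ≅ diffFunctor F :=
  NatIso.ofComponents (fun A =>
    { hom := ⟨Diff.ofHom, Diff.ofHom_conv_comul⟩
      inv := ⟨fun a => liftGen a.coeff, fun a b => by
        apply Diff.ofHom_injective
        refine (Diff.ofHom_liftGen _).trans (Eq.trans ?_ (Diff.ofHom_conv_comul _ _).symm)
        exact (congrArg₂ _ (Diff.ofHom_liftGen a) (Diff.ofHom_liftGen b)).symm⟩
      hom_inv_id := LoopCat.Hom.ext (funext fun α =>
        Diff.ofHom_injective (Diff.ofHom_liftGen (Diff.ofHom α)))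
      inv_hom_id := LoopCat.Hom.ext (funext fun a => Diff.ofHom_liftGen a) })
    fun f => LoopCat.Hom.ext (funext fun α => Diff.ofHom_comp α f)

end Representability

end FdB

theorem mainTheorem1 (F : Type u) [Field F] :
    (∃ S : FdB.Coloop (FdB.H F),
      S.comul = FdB.comul F ∧ S.counit = FdB.counit F ∧
      S.rcodiv = FdB.rcodiv F ∧ S.lcodiv = FdB.lcodiv F ∧
      ∃ Φ : S.functor ≅ FdB.diffFunctor F,
        ∀ (A : AlgCat.{u} F) (α : FdB.H F ⟶ A) (n : ℕ),
          FdB.Diff.coeff ((Φ.hom.app A).toFun α) n = α.hom (FdB.gen F n)) ∧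
    ∀ (A : AlgCat.{u} F) (a b : FdB.Diff A) (n : ℕ), 1 ≤ n →
      (FdB.Loop.rdiv a b).coeff n =
          (FdB.conv (FdB.rcodiv F) (FdB.liftGen a.coeff) (FdB.liftGen b.coeff)).hom
            (FdB.gen F n) ∧
      (FdB.Loop.rdiv a b).coeff n =
          a.coeff n - b.coeff n +
            ∑ ℓ ∈ Finset.Icc 1 (n - 1), (-1 : ℤ) ^ ℓ • ∑ k ∈ FdB.compositions n (ℓ + 1),
              FdB.lagrangeCoeff (fun i : Fin ℓ => k i.castSucc) •
                ((a.coeff (k 0) - b.coeff (k 0)) *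
                  (List.ofFn fun i : Fin ℓ => b.coeff (k i.succ)).prod) ∧
      (FdB.Loop.ldiv a b).coeff n =
          (FdB.conv (FdB.lcodiv F) (FdB.liftGen a.coeff) (FdB.liftGen b.coeff)).hom
            (FdB.gen F n) ∧
      (FdB.Loop.ldiv a b).coeff n =
          b.coeff n - a.coeff n +
            ∑ ℓ ∈ Finset.Icc 1 (n - 1), (-1 : ℤ) ^ ℓ • ∑ k ∈ FdB.compositions n (ℓ + 1),
              ∑ e ∈ FdB.bits ℓ, FdB.bitSign e •
                FdB.labeledLagrangeCoeff e (fun i : Fin ℓ => k i.castSucc) •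
                  ((List.ofFn fun i : Fin ℓ =>
                      if e i = 1 then a.coeff (k i.castSucc)
                      else b.coeff (k i.castSucc)).prod *
                    (b.coeff (k (Fin.last ℓ)) - a.coeff (k (Fin.last ℓ)))) := by
  refine ⟨⟨FdB.faaDiBruno F, rfl, rfl, rfl, rfl, FdB.functorIsoDiff F, fun A α n => rfl⟩,
    fun A a b n hn => ⟨?_, ?_, ?_, ?_⟩⟩
  · have h := FdB.Diff.ofHom_conv_rcodiv (FdB.liftGen a.coeff) (FdB.liftGen b.coeff)
    rw [FdB.Diff.ofHom_liftGen, FdB.Diff.ofHom_liftGen] at h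
    rw [← h]
    rfl
  · refine (FdB.rdivCoeff_eq_sum _ _ a.coeff_zero b.coeff_zero hn).trans ?_
    rw [FdB.sum_range_eq_add_sum_Icc _ hn, FdB.sum_compositions_one _ hn]
    -- For `ℓ = 0` the empty sequence is the only ballot sequence, so the coefficient is `1`.
    simp [FdB.lagrangeCoeff, FdB.ballot]
  · have h := FdB.Diff.ofHom_conv_lcodiv (FdB.liftGen a.coeff) (FdB.liftGen b.coeff)
    rw [FdB.Diff.ofHom_liftGen, FdB.Diff.ofHom_liftGen] at h
    rw [← h]
    rfl
  · refine (FdB.ldivCoeff_eq_sum _ _ a.coeff_zero b.coeff_zero hn).trans ?_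
    rw [FdB.sum_range_eq_add_sum_Icc _ hn, FdB.sum_compositions_one _ hn]
    simp [FdB.labeledLagrangeCoeff, FdB.labeledBallot, FdB.ballot, FdB.bits, FdB.bitSign]
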